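/- Throughout, $n\ge 0$, and a labelled graph of rank $n$ may have parallel edges with different labels and semi-edges, with labels in $\{0,\dots,n-1\}$. Call such a graph $\mathcal G$ *allowable* if it is non-empty and connected, every vertex is incident to exactly one edge or semi-edge of each label (so the graph is $n$-regular and properly edge-coloured), and, whenever $|i-j|>1$, walking from any vertex along edges or semi-edges labelled $i,j,i,j$ leads back to that vertex. An *$(n-1)$-maniplex* is an allowable graph of rank $n$ that is simple (no semi-edges and no two edges joining the same pair of vertices); its vertices are called flags. An *$n$-polytope* is a partially ordered set with a strictly monotone rank function into $\{-1,0,\dots,n\}$ that has a least element, of rank $-1$, and a greatest element, of rank $n$, in which every flag (maximal chain) contains exactly one element of each rank, the diamond condition holds (if $F<G$ and $\operatorname{rank}G-\operatorname{rank}F=2$, exactly two elements of rank $\operatorname{rank}F+1$ lie strictly between $F$ and $G$), and which is strongly connected (if $F<G$ and $\operatorname{rank}G-\operatorname{rank}F\ge 3$, any two elements strictly between $F$ and $G$ are joined by a sequence of such elements in which consecutive ones are comparable). Its flag graph joins two flags by an edge labelled $i\in\{0,\dots,n-1\}$ when they differ exactly in their elements of rank $i$. The *symmetry type graph* of a maniplex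 (resp. polytope) is the quotient of the graph (resp. flag graph) by the group of its label-preserving (resp. rank- and order-preserving) automorphisms: its vertices are the flag orbits, two orbits are joined by an edge labelled $i$ if they contain $i$-adjacent flags, and an orbit containing two $i$-adjacent flags has a semi-edge labelled $i$. **Theorem.** Let $\mathcal G$ be an allowable graph of rank $n$, and let $\hat{\mathcal G}$ be the graph with labels in $\{0,\dots,n\}$ obtained from $\mathcal G$ by attaching a semi-edge labelled $n$ at every vertex. If $\mathcal G$ is (isomorphic, as a labelled graph, to) the symmetry type graph of some $(n-1)$-maniplex, then $\hat{\mathcal G}$ is the symmetry type graph of some $n$-maniplex. If $\mathcal G$ is the symmetry type graph of some $n$-polytope, then $\hat{\mathcal G}$ is the symmetry type graph of some $(n+1)$-polytope. -/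

import Mathlib

universe u v w

/-- A graph on the node set `V` with edges labelled by `0, …, n-1`: `G.adj i a b` says that some
edge labelled `i` joins `a` and `b`.  `G.adj i a a` says that there is a semi-edge labelled `i`
at `a`.  Edges with different labels may join the same two nodes. -/
structure LabelledGraph (n : ℕ) (V : Type u) where
  adj : Fin n → V → V → Prop

namespace LabelledGraph

/-- Edges are undirected. -/
def IsUndirected {n : ℕ} {V : Type u} (G : LabelledGraph n V) : Prop :=
  ∀ i a b, G.adj i a b → G.adj i b a

/-- Properly edge-coloured and `n`-regular: at each node there is exactly one edge or semi-edge
of each label. -/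
def IsProperRegular {n : ℕ} {V : Type u} (G : LabelledGraph n V) : Prop :=
  ∀ i a, ∃! b, G.adj i a b

/-- Connected (in particular non-empty). -/
def IsConnected {n : ℕ} {V : Type u} (G : LabelledGraph n V) : Prop :=
  Nonempty V ∧ ∀ a b, Relation.ReflTransGen (fun x y => ∃ i, G.adj i x y) a b

/-- If `|i - j| > 1`, then walking along edges labelled `i, j, i, j` leads back to the start. -/
def SquaresClose {n : ℕ} {V : Type u} (G : LabelledGraph n V) : Prop :=
  ∀ i j : Fin n, 1 < |((i : ℕ) : ℤ) - ((j : ℕ) : ℤ)| →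
    ∀ a b c d e, G.adj i a b → G.adj j b c → G.adj i c d → G.adj j d e → e = a

/-- Allowable graphs of rank `n`. -/
structure IsAllowable {n : ℕ} {V : Type u} (G : LabelledGraph n V) : Prop where
  undirected : G.IsUndirected
  proper : G.IsProperRegular
  connected : G.IsConnected
  squares : G.SquaresClose

/-- `G` is (the flag graph of) a maniplex with labels `0, …, n-1`, that is, an `(n-1)`-maniplex:
a connected simple graph (no semi-edges, no parallel edges), properly edge-coloured and
`n`-regular, in which for `|i - j| ≥ 2` every node lies on an alternating square with labels
`i` and `j`.  (As the graph is simple, the four nodes of a closed walk `i, j, i, j` are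
distinct.) -/
structure IsManiplex {n : ℕ} {V : Type u} (G : LabelledGraph n V) : Prop where
  undirected : G.IsUndirected
  proper : G.IsProperRegular
  connected : G.IsConnected
  squares : G.SquaresClose
  no_semiedge : ∀ i a, ¬ G.adj i a a
  no_parallel : ∀ i j a b, G.adj i a b → G.adj j a b → i = j

/-- Isomorphisms of labelled graphs: bijections of the nodes that preserve edges and labels. -/
structure Iso {n : ℕ} {V : Type u} {W : Type v} (G : LabelledGraph n V) (H : LabelledGraph n W)
    extends V ≃ W where
  map_adj : ∀ i a b, H.adj i (toEquiv a) (toEquiv b) ↔ G.adj i a b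

/-- The quotient of a labelled graph: two classes are joined by an edge labelled `i` if some
members are; a class has a semi-edge labelled `i` if two (possibly equal) members are joined by
an edge or semi-edge labelled `i`. -/
def quotient {n : ℕ} {V : Type u} (G : LabelledGraph n V) (s : Setoid V) :
    LabelledGraph n (Quotient s) where
  adj i A B := ∃ a b, Quotient.mk s a = A ∧ Quotient.mk s b = B ∧ G.adj i a b

/-- Two nodes are in the same orbit if a label-preserving automorphism takes one to the other. -/
def orbitSetoid {n : ℕ} {V : Type u} (G : LabelledGraph n V) : Setoid V where
  r a b := ∃ γ : G.Iso G, γ.toEquiv a = b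
  iseqv :=
    { refl := fun a => ⟨⟨Equiv.refl V, fun _ _ _ => Iff.rfl⟩, rfl⟩
      symm := by
        rintro a _ ⟨γ, rfl⟩
        refine ⟨⟨γ.toEquiv.symm, fun i x y => ?_⟩, by simp⟩
        have h := γ.map_adj i (γ.toEquiv.symm x) (γ.toEquiv.symm y)
        simpa using h.symm
      trans := by
        rintro a _ _ ⟨γ, rfl⟩ ⟨δ, rfl⟩
        exact ⟨⟨γ.toEquiv.trans δ.toEquiv,
          fun i x y => (δ.map_adj i _ _).trans (γ.map_adj i x y)⟩, rfl⟩ }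

/-- The symmetry type graph of a maniplex: the quotient by its automorphism group. -/
def symmetryTypeGraph {n : ℕ} {V : Type u} (G : LabelledGraph n V) :
    LabelledGraph n (Quotient G.orbitSetoid) :=
  G.quotient G.orbitSetoid

/-- The graph obtained from a graph with labels `0, …, n-1` by attaching a semi-edge labelled `n`
at every node. -/
def attachSemiEdges {n : ℕ} {V : Type u} (G : LabelledGraph n V) : LabelledGraph (n + 1) V where
  adj i a b := Fin.lastCases (motive := fun _ => Prop) (a = b) (fun j => G.adj j a b) i

end LabelledGraph

/-- The structure of an (abstract) `n`-polytope on a partially ordered set `P` of faces.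
The flags are the maximal chains, `Flag P`. -/
structure Polytope (n : ℕ) (P : Type u) [PartialOrder P] where
  /-- the rank function, strictly monotone with values in `{-1, 0, …, n}` -/
  rank : P → ℤ
  rank_strictMono : StrictMono rank
  rank_mem : ∀ F, -1 ≤ rank F ∧ rank F ≤ n
  /-- there is a least face, of rank `-1` -/
  exists_least : ∃ F, (∀ G, F ≤ G) ∧ rank F = -1
  /-- there is a greatest face, of rank `n` -/
  exists_greatest : ∃ F, (∀ G, G ≤ F) ∧ rank F = n
  /-- every flag has exactly one face in each rank -/
  flag_rank : ∀ (Φ : Flag P) (i : ℤ), -1 ≤ i → i ≤ n → ∃! F, F ∈ Φ ∧ rank F = i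
  /-- the diamond condition -/
  diamond : ∀ F G, F < G → rank G - rank F = 2 →
    {H | rank H = rank F + 1 ∧ F < H ∧ H < G}.ncard = 2
  /-- strong connectivity: two faces strictly between `F` and `G` are linked by a sequence of
  such faces in which consecutive ones are incident -/
  strongly_connected : ∀ F G, F < G → 3 ≤ rank G - rank F →
    ∀ H H', F < H → H < G → F < H' → H' < G →
      Relation.ReflTransGen
        (fun A B => (A ≤ B ∨ B ≤ A) ∧ (F < A ∧ A < G) ∧ (F < B ∧ B < G)) H H'

namespace Polytope

/-- The flag graph: two flags are joined by an edge labelled `i` if they are `i`-adjacent, i.e.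
they differ exactly in their faces of rank `i`. -/
def flagGraph {n : ℕ} {P : Type u} [PartialOrder P] (K : Polytope n P) :
    LabelledGraph n (Flag P) where
  adj i Φ Ψ := Φ ≠ Ψ ∧ ∀ F, K.rank F ≠ ((i : ℕ) : ℤ) → (F ∈ Φ ↔ F ∈ Ψ)

/-- Two flags are in the same orbit if an automorphism of the polytope, i.e. a bijection of the
faces that preserves rank and order, takes one to the other. -/
def flagOrbitSetoid {n : ℕ} {P : Type u} [PartialOrder P] (K : Polytope n P) :
    Setoid (Flag P) where
  r Φ Ψ := ∃ γ : P ≃o P, (∀ F, K.rank (γ F) = K.rank F) ∧ Flag.map γ Φ = Ψ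
  iseqv :=
    { refl := fun Φ => ⟨OrderIso.refl P, fun _ => rfl, by
        apply SetLike.coe_injective
        simp⟩
      symm := by
        rintro Φ _ ⟨γ, hγ, rfl⟩
        refine ⟨γ.symm, fun F => ?_, ?_⟩
        · simpa using (hγ (γ.symm F)).symm
        · apply SetLike.coe_injective
          simp [Set.image_image]
      trans := by
        rintro Φ _ _ ⟨γ, hγ, rfl⟩ ⟨δ, hδ, rfl⟩
        refine ⟨γ.trans δ, fun F => (hδ _).trans (hγ F), ?_⟩
        apply SetLike.coe_injective
        simp [Set.image_image] }

/-- The symmetry type graph of a polytope: the quotient of the flag graph by the automorphism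
group of the polytope. -/
def symmetryTypeGraph {n : ℕ} {P : Type u} [PartialOrder P] (K : Polytope n P) :
    LabelledGraph n (Quotient K.flagOrbitSetoid) :=
  K.flagGraph.quotient K.flagOrbitSetoid

end Polytope

namespace LabelledGraph

/-! Take two copies of the graph and join corresponding nodes by edges of the new label `n`
(`LabelledGraph.double`). Each automorphism preserves the matching labelled `n`, so it descends to
the original graph; conversely an automorphism of the original lifts, composed with any permutation
of the two copies. Hence the two copies of a flag share an orbit, orbits of the double are preimages
of the old orbits, and each new edge becomes a semi-edge in the quotient.

For polytopes the same doubling is realised by a poset: replace the greatest face `t` by two facets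
sharing all proper faces, and add a new greatest face (`DoubledFace`). Its flags are pairs of an old
flag and a facet, so its flag graph is the double of the old one (`doubleFlagGraphIso`). Both halves
then follow from `nonempty_iso_quotient_attachSemiEdges`, given the description of the orbits
(`orbitSetoid_double_iff`, `flagOrbitSetoid_double_iff`). -/

theorem attachSemiEdges_adj_last {n : ℕ} {V : Type u} (G : LabelledGraph n V) (a b : V) :
    G.attachSemiEdges.adj (Fin.last n) a b ↔ a = b := by
  simp [attachSemiEdges]

theorem attachSemiEdges_adj_castSucc {n : ℕ} {V : Type u} (G : LabelledGraph n V) (i : Fin n)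
    (a b : V) : G.attachSemiEdges.adj i.castSucc a b ↔ G.adj i a b := by
  simp [attachSemiEdges]

/-- Composition of isomorphisms of labelled graphs. -/
def Iso.trans {n : ℕ} {U : Type u} {V : Type v} {W : Type w} {A : LabelledGraph n U}
    {B : LabelledGraph n V} {C : LabelledGraph n W} (f : A.Iso B) (g : B.Iso C) : A.Iso C where
  toEquiv := f.toEquiv.trans g.toEquiv
  map_adj i a b := (g.map_adj i _ _).trans (f.map_adj i a b)

/-- The inverse of an isomorphism of labelled graphs. -/
def Iso.symm {n : ℕ} {U : Type u} {V : Type v} {A : LabelledGraph n U}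
    {B : LabelledGraph n V} (f : A.Iso B) : B.Iso A where
  toEquiv := f.toEquiv.symm
  map_adj i a b := by simpa using (f.map_adj i (f.toEquiv.symm a) (f.toEquiv.symm b)).symm

/-- An isomorphism of labelled graphs is also one after attaching semi-edges. -/
def Iso.attachSemiEdges {n : ℕ} {U : Type u} {V : Type v} {A : LabelledGraph n U}
    {B : LabelledGraph n V} (f : A.Iso B) : A.attachSemiEdges.Iso B.attachSemiEdges where
  toEquiv := f.toEquiv
  map_adj i a b := by
    induction i using Fin.lastCases with
    | last => simp [attachSemiEdges_adj_last]
    | cast i => simpa [attachSemiEdges_adj_castSucc] using f.map_adj i a b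

/-! ### Doubling a labelled graph and taking quotients -/

/-- Two copies of a labelled graph, joined by a perfect matching with a new label. -/
def double {n : ℕ} {V : Type u} (G : LabelledGraph n V) : LabelledGraph (n + 1) (V × Bool) where
  adj i a b := Fin.lastCases (motive := fun _ => Prop) (a.1 = b.1 ∧ a.2 ≠ b.2)
    (fun j => G.adj j a.1 b.1 ∧ a.2 = b.2) i

theorem double_adj_last {n : ℕ} {V : Type u} (G : LabelledGraph n V) (a b : V × Bool) :
    G.double.adj (Fin.last n) a b ↔ a.1 = b.1 ∧ a.2 ≠ b.2 := by
  simp [double]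

theorem double_adj_castSucc {n : ℕ} {V : Type u} (G : LabelledGraph n V) (i : Fin n)
    (a b : V × Bool) : G.double.adj i.castSucc a b ↔ G.adj i a.1 b.1 ∧ a.2 = b.2 := by
  simp [double]

/-- If `B` is the double of `A` and the classes in `B` are the preimages of those in `A`, then the
quotient of `B` is the quotient of `A` with semi-edges attached. -/
theorem nonempty_iso_quotient_attachSemiEdges {n : ℕ} {V : Type u} {W : Type v}
    (A : LabelledGraph n V) (B : LabelledGraph (n + 1) W) (s : Setoid V) (r : Setoid W)
    (e : A.double.Iso B) (he : ∀ p q : V × Bool, r (e.toEquiv p) (e.toEquiv q) ↔ s p.1 q.1) :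
    Nonempty ((B.quotient r).Iso (A.quotient s).attachSemiEdges) := by
  -- The copy `false` is an arbitrary choice: by `he`, both copies of a node lie in one class.
  let f : Quotient s → Quotient r :=
    Quotient.map (fun x => e.toEquiv (x, false)) (fun x y h => (he _ _).2 h)
  have hf (p : V × Bool) : Quotient.mk r (e.toEquiv p) = f (Quotient.mk s p.1) :=
    Quotient.sound ((he _ _).2 (s.refl _))
  have hbij : Function.Bijective f := by
    constructor
    · rintro ⟨x⟩ ⟨y⟩ h
      exact Quotient.sound ((he (x, false) (y, false)).1 (Quotient.exact h))
    · rintro ⟨y⟩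
      obtain ⟨p, rfl⟩ := e.toEquiv.surjective y
      exact ⟨Quotient.mk s p.1, (hf p).symm⟩
  refine ⟨Iso.symm ⟨Equiv.ofBijective f hbij, fun i X Y => ?_⟩⟩
  have key : (B.quotient r).adj i (f X) (f Y) ↔
      ∃ p q : V × Bool, Quotient.mk s p.1 = X ∧ Quotient.mk s q.1 = Y ∧ A.double.adj i p q := by
    constructor
    · rintro ⟨a, b, ha, hb, hab⟩
      obtain ⟨p, rfl⟩ := e.toEquiv.surjective a
      obtain ⟨q, rfl⟩ := e.toEquiv.surjective b
      rw [hf] at ha hb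
      exact ⟨p, q, hbij.1 ha, hbij.1 hb, (e.map_adj i p q).1 hab⟩
    · rintro ⟨p, q, rfl, rfl, h⟩
      exact ⟨_, _, hf p, hf q, (e.map_adj i p q).2 h⟩
  refine key.trans ?_
  induction i using Fin.lastCases with
  | last =>
    rw [attachSemiEdges_adj_last]
    constructor
    · rintro ⟨p, q, rfl, rfl, h⟩
      rw [((double_adj_last _ _ _).1 h).1]
    · rintro rfl
      obtain ⟨x, rfl⟩ := Quotient.exists_rep X
      -- The new edge between the two copies of `x` collapses to the semi-edge.
      exact ⟨(x, false), (x, true), rfl, rfl, by simp [double_adj_last]⟩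
  | cast i =>
    rw [attachSemiEdges_adj_castSucc]
    constructor
    · rintro ⟨p, q, rfl, rfl, h⟩
      exact ⟨p.1, q.1, rfl, rfl, ((double_adj_castSucc _ _ _ _).1 h).1⟩
    · rintro ⟨x, y, rfl, rfl, h⟩
      exact ⟨(x, false), (y, false), rfl, rfl, by simpa [double_adj_castSucc] using h⟩

/-- The matching commutes with every old label, which closes the new squares. The Boolean coordinate
changes exactly along the new edges, so these are not loops and are parallel to no old edge. -/
theorem IsManiplex.double {n : ℕ} {V : Type u} {G : LabelledGraph n V} (hG : G.IsManiplex) :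
    G.double.IsManiplex where
  undirected i a b h := by
    induction i using Fin.lastCases with
    | last =>
      rw [double_adj_last] at h ⊢
      exact ⟨h.1.symm, h.2.symm⟩
    | cast i =>
      rw [double_adj_castSucc] at h ⊢
      exact ⟨hG.undirected _ _ _ h.1, h.2.symm⟩
  proper i a := by
    induction i using Fin.lastCases with
    | last =>
      refine ⟨(a.1, !a.2), by simp [double_adj_last], fun b h => ?_⟩
      have h := (double_adj_last _ _ _).1 h
      exact Prod.ext h.1.symm (Bool.eq_not_of_ne h.2.symm)
    | cast i =>
      obtain ⟨b, hb, hu⟩ := hG.proper i a.1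
      refine ⟨(b, a.2), by simpa [double_adj_castSucc] using hb, fun c h => ?_⟩
      have h := (double_adj_castSucc _ _ _ _).1 h
      exact Prod.ext (hu _ h.1) h.2.symm
  connected := by
    obtain ⟨⟨x⟩, hc⟩ := hG.connected
    refine ⟨⟨(x, false)⟩, fun a b => ?_⟩
    have h₁ : Relation.ReflTransGen (fun x y => ∃ i, G.double.adj i x y) a (b.1, a.2) :=
      Relation.ReflTransGen.lift (fun x => (x, a.2))
        (fun _ _ ⟨i, h⟩ => ⟨i.castSucc, by simpa [double_adj_castSucc] using h⟩)
        _ _ (hc a.1 b.1)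
    by_cases h : a.2 = b.2
    · rwa [h] at h₁
    · exact h₁.tail ⟨Fin.last n, by simpa [double_adj_last] using h⟩
  squares i j hij a b c d e hab hbc hcd hde := by
    induction i using Fin.lastCases with
    | last =>
      induction j using Fin.lastCases with
      | last => simp at hij
      | cast j =>
        rw [double_adj_last] at hab hcd
        rw [double_adj_castSucc] at hbc hde
        have h : e.1 = b.1 := (hG.proper j d.1).unique hde.1
          (hcd.1 ▸ hG.undirected _ _ _ hbc.1)
        refine Prod.ext (h.trans hab.1.symm) ?_
        rw [← hde.2, Bool.eq_not_of_ne hcd.2.symm, ← hbc.2, Bool.eq_not_of_ne hab.2.symm,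
          Bool.not_not]
    | cast i =>
      induction j using Fin.lastCases with
      | last =>
        rw [double_adj_castSucc] at hab hcd
        rw [double_adj_last] at hbc hde
        have h : d.1 = a.1 := (hG.proper i c.1).unique hcd.1
          (hbc.1 ▸ hG.undirected _ _ _ hab.1)
        refine Prod.ext (hde.1.symm.trans h) ?_
        rw [Bool.eq_not_of_ne hde.2.symm, ← hcd.2, Bool.eq_not_of_ne hbc.2.symm, ← hab.2,
          Bool.not_not]
      | cast j =>
        rw [double_adj_castSucc] at hab hbc hcd hde
        exact Prod.ext (hG.squares i j (by simpa using hij) _ _ _ _ _ hab.1 hbc.1 hcd.1 hde.1)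
          (by rw [hab.2, hbc.2, hcd.2, hde.2])
  no_semiedge i a h := by
    induction i using Fin.lastCases with
    | last => exact ((double_adj_last _ _ _).1 h).2 rfl
    | cast i => exact hG.no_semiedge i _ ((double_adj_castSucc _ _ _ _).1 h).1
  no_parallel i j a b h h' := by
    induction i using Fin.lastCases with
    | last =>
      induction j using Fin.lastCases with
      | last => rfl
      | cast j => exact absurd ((double_adj_castSucc _ _ _ _).1 h').2 ((double_adj_last _ _ _).1 h).2
    | cast i =>
      induction j using Fin.lastCases with
      | last => exact absurd ((double_adj_castSucc _ _ _ _).1 h).2 ((double_adj_last _ _ _).1 h').2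
      | cast j =>
        rw [hG.no_parallel i j _ _ ((double_adj_castSucc _ _ _ _).1 h).1
          ((double_adj_castSucc _ _ _ _).1 h').1]

/-! ### Automorphisms and orbits of the double -/

/-- An automorphism of the double acts in the same way on both copies. -/
theorem Iso.double_fst_eq {n : ℕ} {V : Type u} {G : LabelledGraph n V} (γ : G.double.Iso G.double)
    (x : V) (a b : Bool) : (γ.toEquiv (x, a)).1 = (γ.toEquiv (x, b)).1 := by
  by_cases h : a = b
  · rw [h]
  · have := (γ.map_adj (Fin.last n) (x, a) (x, b)).2 ((double_adj_last _ _ _).2 ⟨rfl, h⟩)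
    exact ((double_adj_last _ _ _).1 this).1

theorem Iso.adj_double_fst {n : ℕ} {V : Type u} {G : LabelledGraph n V}
    (γ : G.double.Iso G.double) {i : Fin n} {x y : V} (h : G.adj i x y) :
    G.adj i (γ.toEquiv (x, false)).1 (γ.toEquiv (y, false)).1 := by
  have := (γ.map_adj i.castSucc (x, false) (y, false)).2 ((double_adj_castSucc _ _ _ _).2 ⟨h, rfl⟩)
  exact ((double_adj_castSucc _ _ _ _).1 this).1

/-- Projecting forgets in which copy the image of `(x, false)` lies; this is harmless because the
inverse also acts alike on both copies. -/
theorem Iso.symm_double_fst {n : ℕ} {V : Type u} {G : LabelledGraph n V}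
    (γ : G.double.Iso G.double) (x : V) :
    (γ.symm.toEquiv ((γ.toEquiv (x, false)).1, false)).1 = x := by
  rw [γ.symm.double_fst_eq _ false (γ.toEquiv (x, false)).2]
  simp [Iso.symm]

/-- The automorphism of a graph induced by an automorphism of its double. -/
def Iso.ofDouble {n : ℕ} {V : Type u} {G : LabelledGraph n V} (γ : G.double.Iso G.double) :
    G.Iso G where
  toFun x := (γ.toEquiv (x, false)).1
  invFun x := (γ.symm.toEquiv (x, false)).1
  left_inv := γ.symm_double_fst
  right_inv := γ.symm.symm_double_fst
  map_adj i x y := by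
    refine ⟨fun h => ?_, γ.adj_double_fst⟩
    have := γ.symm.adj_double_fst h
    exact γ.symm_double_fst x ▸ γ.symm_double_fst y ▸ this

/-- An automorphism of a graph and a permutation of the two copies give an automorphism of the
double. -/
def Iso.double {n : ℕ} {V : Type u} {G : LabelledGraph n V} (γ : G.Iso G) (σ : Bool ≃ Bool) :
    G.double.Iso G.double where
  toEquiv := γ.toEquiv.prodCongr σ
  map_adj i a b := by
    induction i using Fin.lastCases with
    | last => simp [double_adj_last]
    | cast i => simp [double_adj_castSucc, γ.map_adj]

end LabelledGraph

theorem Bool.exists_equiv_apply_eq (a b : Bool) : ∃ σ : Bool ≃ Bool, σ a = b :=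
  ⟨Equiv.swap a b, Equiv.swap_apply_left a b⟩

namespace LabelledGraph

theorem orbitSetoid_double_iff {n : ℕ} {V : Type u} (G : LabelledGraph n V) (p q : V × Bool) :
    G.double.orbitSetoid p q ↔ G.orbitSetoid p.1 q.1 := by
  constructor
  · rintro ⟨γ, rfl⟩
    exact ⟨γ.ofDouble, γ.double_fst_eq p.1 false p.2⟩
  · rintro ⟨γ, h⟩
    obtain ⟨σ, hσ⟩ := Bool.exists_equiv_apply_eq p.2 q.2
    exact ⟨γ.double σ, Prod.ext h hσ⟩

theorem nonempty_iso_symmetryTypeGraph_double {n : ℕ} {V : Type u} (G : LabelledGraph n V) :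
    Nonempty (G.double.symmetryTypeGraph.Iso G.symmetryTypeGraph.attachSemiEdges) :=
  nonempty_iso_quotient_attachSemiEdges G G.double _ _ ⟨Equiv.refl _, fun _ _ _ => Iff.rfl⟩
    G.orbitSetoid_double_iff

end LabelledGraph

/-! ### Faces and order of the trivial extension -/

/-- Faces of the trivial extension of a polytope with greatest face `t`: the other faces of the
polytope, two facets, and a new greatest face. -/
inductive DoubledFace {P : Type u} (t : P) : Type u
  | proper (x : P) (hx : x ≠ t)
  | facet (b : Bool)
  | top

namespace DoubledFace

section Incl

variable {P : Type u} {t : P}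

/-- The faces of the polytope as faces below one of the two facets of the trivial extension. -/
noncomputable def incl (t : P) (b : Bool) (x : P) : DoubledFace t :=
  open Classical in if h : x = t then facet b else proper x h

@[simp] theorem incl_self (b : Bool) : incl t b t = facet b := by simp [incl]
theorem incl_of_ne (b : Bool) {x : P} (hx : x ≠ t) : incl t b x = proper x hx := by simp [incl, hx]

theorem exists_eq_incl (q : DoubledFace t) : q = top ∨ ∃ b x, q = incl t b x := by
  cases q with
  | proper x hx => exact Or.inr ⟨false, x, (incl_of_ne _ hx).symm⟩
  | facet b => exact Or.inr ⟨b, t, (incl_self b).symm⟩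
  | top => exact Or.inl rfl

/-- The map identifying the two facets and the greatest face. -/
def collapse : DoubledFace t → P
  | proper x _ => x
  | facet _ => t
  | top => t

@[simp] theorem collapse_proper {x : P} (hx : x ≠ t) : collapse (proper x hx) = x := rfl
@[simp] theorem collapse_facet (b : Bool) : collapse (facet b : DoubledFace t) = t := rfl
@[simp] theorem collapse_top : collapse (top : DoubledFace t) = t := rfl

@[simp] theorem collapse_incl (b : Bool) (x : P) : collapse (incl t b x) = x := by
  by_cases hx : x = t
  · simp [hx]
  · simp [incl_of_ne b hx]

end Incl

section Order

variable {P : Type u} [PartialOrder P] {t : P}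

/-- The order on the faces of the trivial extension. -/
protected def Le : DoubledFace t → DoubledFace t → Prop
  | _, top => True
  | proper x _, proper y _ => x ≤ y
  | proper _ _, facet _ => True
  | facet a, facet b => a = b
  | facet _, proper _ _ => False
  | top, proper _ _ => False
  | top, facet _ => False

instance : PartialOrder (DoubledFace t) where
  le := DoubledFace.Le
  le_refl a := by cases a <;> simp [DoubledFace.Le]
  le_trans a b c hab hbc := by
    cases a <;> cases b <;> cases c <;> simp_all [DoubledFace.Le]
    exact hab.trans hbc
  le_antisymm a b hab hba := by
    cases a <;> cases b <;> simp_all [DoubledFace.Le]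
    exact le_antisymm hab hba

@[simp] theorem le_top' (a : DoubledFace t) : a ≤ top := by cases a <;> trivial
@[simp] theorem proper_le_proper {x y : P} {hx : x ≠ t} {hy : y ≠ t} :
    proper x hx ≤ proper y hy ↔ x ≤ y := Iff.rfl
@[simp] theorem proper_le_facet {x : P} {hx : x ≠ t} {b : Bool} :
    proper x hx ≤ facet b := trivial
@[simp] theorem facet_le_facet {a b : Bool} : (facet a : DoubledFace t) ≤ facet b ↔ a = b := Iff.rfl
@[simp] theorem not_facet_le_proper {x : P} {hx : x ≠ t} {b : Bool} :
    ¬ facet b ≤ proper x hx := id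
@[simp] theorem not_top_le_proper {x : P} {hx : x ≠ t} : ¬ top ≤ proper x hx := id
@[simp] theorem not_top_le_facet {b : Bool} : ¬ (top : DoubledFace t) ≤ facet b := id

theorem incl_le_incl (ht : ∀ x, x ≤ t) (b : Bool) {x y : P} :
    incl t b x ≤ incl t b y ↔ x ≤ y := by
  by_cases hx : x = t <;> by_cases hy : y = t
  · simp [hx, hy]
  · subst hx
    simpa [incl_of_ne b hy] using fun h => hy (le_antisymm (ht y) h)
  · subst hy
    simp [incl_of_ne b hx, ht]
  · simp [incl_of_ne b hx, incl_of_ne b hy]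

theorem incl_injective (ht : ∀ x, x ≤ t) (b : Bool) : Function.Injective (incl t b) := fun _ _ h =>
  le_antisymm ((incl_le_incl ht b).1 h.le) ((incl_le_incl ht b).1 h.ge)

theorem incl_lt_incl (ht : ∀ x, x ≤ t) (b : Bool) {x y : P} :
    incl t b x < incl t b y ↔ x < y := by
  simp only [lt_iff_le_not_ge, incl_le_incl ht]

/-- The image of `incl t b` is a lower set. With `incl_le_incl`, every interval below a facet is
thus a copy of an interval of `P`. -/
theorem exists_eq_incl_of_le_incl {q : DoubledFace t} {b : Bool} {y : P} (h : q ≤ incl t b y) :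
    ∃ x, q = incl t b x := by
  cases q with
  | proper x hx => exact ⟨x, (incl_of_ne b hx).symm⟩
  | facet a =>
    by_cases hy : y = t
    · subst hy
      rw [incl_self, facet_le_facet] at h
      exact ⟨y, by rw [h, incl_self]⟩
    · simp [incl_of_ne b hy] at h
  | top => by_cases hy : y = t <;> simp [incl, hy] at h

theorem collapse_mono (ht : ∀ x, x ≤ t) : Monotone (collapse : DoubledFace t → P) := by
  intro a b h
  cases a <;> cases b <;> simp_all

end Order

/-! ### Flags of the trivial extension -/

section Flags

variable {P : Type u} [PartialOrder P] {t : P}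

theorem _root_.Flag.mem_of_forall_comparable {Q : Type u} [PartialOrder Q] (Φ : Flag Q) {q : Q}
    (h : ∀ p ∈ Φ, p ≤ q ∨ q ≤ p) : q ∈ Φ := by
  have hc : IsChain (· ≤ ·) (insert q (Φ : Set Q)) :=
    Φ.chain_le.insert fun b hb _ => (h b hb).symm
  have h' : (Φ : Set Q) = insert q (Φ : Set Q) := Φ.max_chain' hc (Set.subset_insert _ _)
  rw [← SetLike.mem_coe, h']
  exact Set.mem_insert q (Φ : Set Q)

theorem _root_.Flag.eq_of_le {Q : Type u} [PartialOrder Q] {Φ Ψ : Flag Q}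
    (h : ∀ q ∈ Φ, q ∈ Ψ) : Φ = Ψ :=
  SetLike.coe_injective (Φ.max_chain' Ψ.chain_le h)

/-- The flag of the trivial extension given by a flag of the polytope and one of the facets. -/
def liftFlag (ht : ∀ x, x ≤ t) (Φ : Flag P) (b : Bool) : Flag (DoubledFace t) where
  carrier := {q | collapse q ∈ Φ ∧ q ≠ facet !b}
  Chain' := by
    rintro p ⟨hp, hp'⟩ q ⟨hq, hq'⟩ -
    have := Φ.le_or_le hp hq
    cases p <;> cases q <;> simp_all
  max_chain' := by
    intro s hs hsub
    refine hsub.antisymm fun q hq => ?_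
    have htop : facet b ∈ s :=
      hsub ⟨Φ.mem_of_forall_comparable fun p _ => Or.inl (ht p), by simp⟩
    refine ⟨Φ.mem_of_forall_comparable fun p hp => ?_, ?_⟩
    · by_cases hpt : p = t
      · subst hpt
        exact Or.inr (ht _)
      -- A proper face of `Φ` already lies in `s`, so it is comparable with `q`; `collapse` carries
      -- the comparison to `P`.
      · have hps : proper p hpt ∈ s := hsub ⟨hp, by simp⟩
        exact (hs.total hps hq).imp (fun h => by simpa using collapse_mono ht h)
          (fun h => by simpa using collapse_mono ht h)
    · rintro rfl
      rcases hs.total htop hq with h | h <;> simp at h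

theorem mem_liftFlag {ht : ∀ x, x ≤ t} {Φ : Flag P} {b : Bool} {q : DoubledFace t} :
    q ∈ liftFlag ht Φ b ↔ collapse q ∈ Φ ∧ q ≠ facet !b := Iff.rfl

theorem _root_.Flag.greatest_mem (ht : ∀ x, x ≤ t) (Φ : Flag P) : t ∈ Φ :=
  Φ.mem_of_forall_comparable fun p _ => Or.inl (ht p)

@[simp] theorem proper_mem_liftFlag {ht : ∀ x, x ≤ t} {Φ : Flag P} {b : Bool} {x : P}
    {hx : x ≠ t} : proper x hx ∈ liftFlag ht Φ b ↔ x ∈ Φ := by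
  simp [mem_liftFlag]

@[simp] theorem facet_mem_liftFlag {ht : ∀ x, x ≤ t} {Φ : Flag P} {a b : Bool} :
    facet a ∈ liftFlag ht Φ b ↔ a = b := by
  simp [mem_liftFlag, Φ.greatest_mem ht]

@[simp] theorem top_mem_liftFlag {ht : ∀ x, x ≤ t} {Φ : Flag P} {b : Bool} :
    top ∈ liftFlag ht Φ b := by
  simp [mem_liftFlag, Φ.greatest_mem ht]

/-- A flag without facets consists of proper faces and possibly `top`, all comparable with `facet
false`, contradicting maximality. -/
theorem exists_facet_mem (Ψ : Flag (DoubledFace t)) : ∃ b, facet b ∈ Ψ := by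
  by_contra! h
  refine h false (Ψ.mem_of_forall_comparable fun p hp => ?_)
  cases p with
  | proper x hx => simp
  | facet b => exact absurd hp (h b)
  | top => simp

/-- The flag of the polytope obtained by identifying the facets of the trivial extension. -/
def collapseFlag (ht : ∀ x, x ≤ t) (Ψ : Flag (DoubledFace t)) : Flag P where
  carrier := {x | ∃ q ∈ Ψ, collapse q = x}
  Chain' := by
    rintro _ ⟨p, hp, rfl⟩ _ ⟨q, hq, rfl⟩ -
    exact (Ψ.le_or_le hp hq).imp (fun h => collapse_mono ht h) (fun h => collapse_mono ht h)
  max_chain' := by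
    intro s hs hsub
    refine hsub.antisymm fun x hx => ?_
    obtain ⟨b, hb⟩ := exists_facet_mem Ψ
    by_cases hxt : x = t
    · exact ⟨facet b, hb, hxt.symm⟩
    · refine ⟨proper x hxt, Ψ.mem_of_forall_comparable fun p hp => ?_, rfl⟩
      cases p with
      | proper y hy => exact hs.total (hsub ⟨_, hp, rfl⟩) hx
      | facet a => simp
      | top => simp

theorem exists_eq_liftFlag (ht : ∀ x, x ≤ t) (Ψ : Flag (DoubledFace t)) :
    ∃ Φ b, liftFlag ht Φ b = Ψ := by
  obtain ⟨b, hb⟩ := exists_facet_mem Ψ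
  refine ⟨collapseFlag ht Ψ, b, Eq.symm ?_⟩
  -- Inclusion of flags suffices; it holds because a chain cannot contain both facets.
  refine Flag.eq_of_le fun q hq => ⟨⟨q, hq, rfl⟩, ?_⟩
  rintro rfl
  rcases Ψ.le_or_le hb hq with h | h <;> simp at h

theorem liftFlag_inj {ht : ∀ x, x ≤ t} {Φ Φ' : Flag P} {b b' : Bool} :
    liftFlag ht Φ b = liftFlag ht Φ' b' ↔ Φ = Φ' ∧ b = b' := by
  refine ⟨fun h => ⟨Flag.eq_of_le fun x hx => ?_, ?_⟩, by rintro ⟨rfl, rfl⟩; rfl⟩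
  · by_cases hxt : x = t
    · exact hxt ▸ Φ'.greatest_mem ht
    · have : proper x hxt ∈ liftFlag ht Φ b := by simpa
      rw [h] at this
      simpa using this
  · have : facet b ∈ liftFlag ht Φ b := by simp
    rw [h] at this
    simpa using this

/-- Flags of the trivial extension are flags of the polytope together with a facet. -/
noncomputable def flagEquiv (ht : ∀ x, x ≤ t) : Flag P × Bool ≃ Flag (DoubledFace t) :=
  Equiv.ofBijective (fun p => liftFlag ht p.1 p.2)
    ⟨fun p q h => Prod.ext_iff.2 (liftFlag_inj.1 h), fun Ψ => by
      obtain ⟨Φ, b, h⟩ := exists_eq_liftFlag ht Ψ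
      exact ⟨(Φ, b), h⟩⟩

/-- The map on faces of the trivial extension given by an automorphism of the polytope and a
permutation of the facets. -/
def mapFun (γ : P ≃o P) (hγ : γ t = t) (σ : Bool → Bool) : DoubledFace t → DoubledFace t
  | proper x hx => proper (γ x) fun h => hx (γ.injective (h.trans hγ.symm))
  | facet b => facet (σ b)
  | top => top

/-- The automorphism of the trivial extension given by an automorphism of the polytope and a
permutation of the facets. -/
def mapIso (γ : P ≃o P) (hγ : γ t = t) (σ : Bool ≃ Bool) : DoubledFace t ≃o DoubledFace t where
  toFun := mapFun γ hγ σ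
  invFun := mapFun γ.symm (by rw [OrderIso.symm_apply_eq, hγ]) σ.symm
  left_inv q := by cases q <;> simp [mapFun]
  right_inv q := by cases q <;> simp [mapFun]
  map_rel_iff' {p q} := by cases p <;> cases q <;> simp [mapFun]

end Flags

end DoubledFace

/-! ### The trivial extension is a polytope -/

namespace Polytope

open DoubledFace

variable {n : ℕ} {P : Type u} [PartialOrder P]

theorem rank_greatest (K : Polytope n P) {t : P} (ht : ∀ x, x ≤ t) : K.rank t = n := by
  obtain ⟨s, hs, h⟩ := K.exists_greatest
  rwa [le_antisymm (ht s) (hs t)] at h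

theorem rank_lt (K : Polytope n P) {t : P} (ht : ∀ x, x ≤ t) {x : P} (hx : x ≠ t) :
    K.rank x < n :=
  K.rank_greatest ht ▸ K.rank_strictMono (lt_of_le_of_ne (ht x) hx)

theorem exists_lt_rank_eq_add_one (K : Polytope n P) (x : P) (hx : K.rank x < n) :
    ∃ y, x < y ∧ K.rank y = K.rank x + 1 := by
  obtain ⟨Φ, hΦ⟩ := Flag.exists_mem x
  obtain ⟨y, ⟨hy, hr⟩, -⟩ :=
    K.flag_rank Φ (K.rank x + 1) (by linarith [(K.rank_mem x).1]) (by omega)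
  refine ⟨y, ?_, hr⟩
  rcases Φ.le_or_le hΦ hy with h | h
  · exact lt_of_le_of_ne h (by rintro rfl; omega)
  · have := K.rank_strictMono.monotone h
    omega

/-- The rank function of the trivial extension. -/
def doubledRank (K : Polytope n P) (t : P) : DoubledFace t → ℤ
  | proper x _ => K.rank x
  | facet _ => n
  | top => n + 1

@[simp] theorem doubledRank_proper (K : Polytope n P) {t x : P} (hx : x ≠ t) :
    K.doubledRank t (proper x hx) = K.rank x := rfl
@[simp] theorem doubledRank_facet (K : Polytope n P) (t : P) (b : Bool) :
    K.doubledRank t (facet b) = n := rfl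
@[simp] theorem doubledRank_top (K : Polytope n P) (t : P) :
    K.doubledRank t top = n + 1 := rfl

theorem doubledRank_incl (K : Polytope n P) {t : P} (ht : ∀ x, x ≤ t) (b : Bool) (x : P) :
    K.doubledRank t (incl t b x) = K.rank x := by
  by_cases hx : x = t
  · subst hx
    simp [K.rank_greatest ht]
  · simp [incl_of_ne b hx]

theorem doubledRank_strictMono (K : Polytope n P) {t : P} (ht : ∀ x, x ≤ t) :
    StrictMono (K.doubledRank t) := by
  intro p q h
  rw [lt_iff_le_not_ge] at h
  cases p with
  | proper x hx =>
    have := K.rank_lt ht hx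
    cases q with
    | proper y hy => exact K.rank_strictMono (lt_iff_le_not_ge.2 (by simpa using h))
    | facet b => simpa
    | top => simp; omega
  | facet a =>
    cases q with
    | proper y hy => simp at h
    | facet b => exact absurd h.1.symm h.2
    | top => simp
  | top => simp at h

/-- Below `top`, a face of rank `n - 1` has exactly the two facets above it; any other interval lies
below a facet and is copied from `P`. -/
theorem doubled_diamond (K : Polytope n P) {t : P} (ht : ∀ x, x ≤ t) (F G : DoubledFace t)
    (hFG : F < G) (hr : K.doubledRank t G - K.doubledRank t F = 2) :
    {H | K.doubledRank t H = K.doubledRank t F + 1 ∧ F < H ∧ H < G}.ncard = 2 := by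
  rcases exists_eq_incl G with rfl | ⟨b, y, rfl⟩
  · have : {H | K.doubledRank t H = K.doubledRank t F + 1 ∧ F < H ∧ H < top} =
        {facet false, facet true} := by
      rw [doubledRank_top] at hr
      ext H
      simp only [Set.mem_ofPred_eq, Set.mem_insert_iff, Set.mem_singleton_iff]
      cases F with
      | proper x hx =>
        rw [doubledRank_proper] at hr
        cases H with
        | proper y hy =>
          have := K.rank_lt ht hy
          simp; omega
        | facet b => cases b <;> simp [lt_iff_le_not_ge] <;> omega
        | top => simp
      | facet b => simp at hr
      | top => simp at hr
    rw [this, Set.ncard_pair (by simp)]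
  · obtain ⟨x, rfl⟩ := exists_eq_incl_of_le_incl hFG.le
    rw [incl_lt_incl ht] at hFG
    simp only [doubledRank_incl K ht] at hr ⊢
    rw [← K.diamond x y hFG hr, ← Set.ncard_image_of_injective _ (incl_injective ht b)]
    congr 1
    ext H
    constructor
    · rintro ⟨h₁, h₂, h₃⟩
      obtain ⟨h, rfl⟩ := exists_eq_incl_of_le_incl h₃.le
      rw [incl_lt_incl ht] at h₂ h₃
      rw [doubledRank_incl K ht] at h₁
      exact ⟨h, ⟨h₁, h₂, h₃⟩, rfl⟩
    · rintro ⟨h, ⟨h₁, h₂, h₃⟩, rfl⟩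
      simpa [incl_lt_incl ht, doubledRank_incl K ht] using ⟨h₁, h₂, h₃⟩

theorem doubled_strongly_connected (K : Polytope n P) {t : P} (ht : ∀ x, x ≤ t)
    (F G : DoubledFace t) (hFG : F < G) (hr : 3 ≤ K.doubledRank t G - K.doubledRank t F)
    (H H' : DoubledFace t) (hFH : F < H) (hHG : H < G) (hFH' : F < H') (hHG' : H' < G) :
    Relation.ReflTransGen
      (fun A B => (A ≤ B ∨ B ≤ A) ∧ (F < A ∧ A < G) ∧ (F < B ∧ B < G)) H H' := by
  rcases exists_eq_incl G with rfl | ⟨b, y, rfl⟩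
  · cases F with
    | facet b => simp at hr
    | top => simp at hr
    | proper x hx =>
      simp only [doubledRank_top, doubledRank_proper] at hr
      -- Here `x` has rank at most `n - 2`, so `z` has rank at most `n - 1` and is proper. It lies
      -- below both facets and serves as a hub: proper faces reach it through `facet false`, facets
      -- directly.
      obtain ⟨z, hxz, hz⟩ := K.exists_lt_rank_eq_add_one x (by omega)
      have hzt : z ≠ t := by
        rintro rfl
        have := K.rank_greatest ht
        omega
      have hxz' : proper x hx < proper z hzt := by
        simpa [lt_iff_le_not_ge] using lt_iff_le_not_ge.1 hxz
      have hzt' : proper z hzt < top := by simp [lt_iff_le_not_ge]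
      have hxf : proper x hx < facet false := by simp [lt_iff_le_not_ge]
      have hft : (facet false : DoubledFace t) < top := by simp [lt_iff_le_not_ge]
      have key : ∀ A : DoubledFace t, proper x hx < A → A < top → Relation.ReflTransGen
          (fun A B => (A ≤ B ∨ B ≤ A) ∧ (proper x hx < A ∧ A < top) ∧ (proper x hx < B ∧ B < top))
          A (proper z hzt) := by
        intro A hA hA'
        cases A with
        | proper a ha =>
          exact .tail (.single (b := facet false) ⟨by simp, ⟨hA, hA'⟩, hxf, hft⟩)
            ⟨by simp, ⟨hxf, hft⟩, hxz', hzt'⟩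
        | facet b => exact .single ⟨by simp, ⟨hA, hA'⟩, hxz', hzt'⟩
        | top => exact absurd hA' (lt_irrefl _)
      have : Std.Symm fun A B : DoubledFace t =>
          (A ≤ B ∨ B ≤ A) ∧ (proper x hx < A ∧ A < top) ∧ (proper x hx < B ∧ B < top) :=
        ⟨fun A B h => ⟨h.1.symm, h.2.2, h.2.1⟩⟩
      refine (key H hFH hHG).trans (symm_of _ (key H' hFH' hHG'))
  · obtain ⟨x, rfl⟩ := exists_eq_incl_of_le_incl hFG.le
    obtain ⟨h, rfl⟩ := exists_eq_incl_of_le_incl hHG.le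
    obtain ⟨h', rfl⟩ := exists_eq_incl_of_le_incl hHG'.le
    simp only [incl_lt_incl ht, doubledRank_incl K ht] at hFG hFH hHG hFH' hHG' hr
    refine Relation.ReflTransGen.lift (incl t b) ?_
      _ _ (K.strongly_connected x y hFG hr h h' hFH hHG hFH' hHG')
    intro A B hAB
    simpa only [Function.onFun, incl_lt_incl ht, incl_le_incl ht] using hAB

theorem doubled_flag_rank (K : Polytope n P) {t : P} (ht : ∀ x, x ≤ t) (Ψ : Flag (DoubledFace t))
    (i : ℤ) (hi : -1 ≤ i) (hi' : i ≤ n + 1) : ∃! F, F ∈ Ψ ∧ K.doubledRank t F = i := by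
  obtain ⟨Φ, b, rfl⟩ := exists_eq_liftFlag ht Ψ
  rcases lt_trichotomy i n with h | h | h
  · obtain ⟨x, ⟨hx, hr⟩, hu⟩ := K.flag_rank Φ i hi h.le
    have hxt : x ≠ t := by
      rintro rfl
      have := K.rank_greatest ht
      omega
    refine ⟨proper x hxt, ⟨by simpa, hr⟩, ?_⟩
    rintro (⟨y, hy⟩ | a | _) ⟨hF, hF'⟩
    · simpa using hu y ⟨by simpa using hF, hF'⟩
    · simp at hF'; omega
    · simp at hF'; omega
  · refine ⟨facet b, ⟨by simp, h.symm⟩, ?_⟩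
    rintro (⟨y, hy⟩ | a | _) ⟨hF, hF'⟩
    · have := K.rank_lt ht hy
      simp at hF'; omega
    · simpa using hF
    · simp at hF'; omega
  · refine ⟨top, ⟨by simp, by simp; omega⟩, ?_⟩
    rintro (⟨y, hy⟩ | a | _) ⟨hF, hF'⟩
    · have := K.rank_lt ht hy
      simp at hF'; omega
    · simp at hF'; omega
    · rfl

/-- The trivial extension of a polytope: it has two facets, both isomorphic to the polytope, with
the same proper faces. -/
def double (K : Polytope n P) {t : P} (ht : ∀ x, x ≤ t) : Polytope (n + 1) (DoubledFace t) where
  rank := K.doubledRank t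
  rank_strictMono := K.doubledRank_strictMono ht
  rank_mem F := by
    cases F with
    | proper x hx =>
      have := K.rank_mem x
      simp; omega
    | facet b => simp
    | top => simp; omega
  exists_least := by
    obtain ⟨m, hm, hr⟩ := K.exists_least
    have hmt : m ≠ t := by
      rintro rfl
      have := K.rank_greatest ht
      omega
    refine ⟨proper m hmt, fun F => ?_, hr⟩
    cases F <;> simp [hm]
  exists_greatest := ⟨top, le_top', by simp⟩
  flag_rank Ψ i hi hi' := K.doubled_flag_rank ht Ψ i hi (by simpa using hi')
  diamond := K.doubled_diamond ht
  strongly_connected := K.doubled_strongly_connected ht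

/-! ### Flag graph and automorphisms of the trivial extension -/

/-- The flag graph of the trivial extension is the double of the flag graph. -/
noncomputable def doubleFlagGraphIso (K : Polytope n P) {t : P} (ht : ∀ x, x ≤ t) :
    K.flagGraph.double.Iso (K.double ht).flagGraph where
  toEquiv := flagEquiv ht
  map_adj i := by
    rintro ⟨Φ, a⟩ ⟨Ψ, b⟩
    change liftFlag ht Φ a ≠ liftFlag ht Ψ b ∧ (∀ F, K.doubledRank t F ≠ ((i : ℕ) : ℤ) →
      (F ∈ liftFlag ht Φ a ↔ F ∈ liftFlag ht Ψ b)) ↔ _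
    induction i using Fin.lastCases with
    | last =>
      rw [LabelledGraph.double_adj_last]
      constructor
      · rintro ⟨hne, h⟩
        have : Φ = Ψ := Flag.eq_of_le fun x hx => by
          by_cases hxt : x = t
          · exact hxt ▸ Ψ.greatest_mem ht
          · have := h (proper x hxt) (by simpa using (K.rank_lt ht hxt).ne)
            simp only [proper_mem_liftFlag] at this
            exact this.1 hx
        exact ⟨this, fun hab => hne (liftFlag_inj.2 ⟨this, hab⟩)⟩
      · rintro ⟨rfl, hab⟩
        refine ⟨fun h => hab (liftFlag_inj.1 h).2, fun F hF => ?_⟩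
        cases F <;> simp_all
    | cast i =>
      rw [LabelledGraph.double_adj_castSucc]
      have hi := i.2
      constructor
      · rintro ⟨hne, h⟩
        -- Facets have rank `n`, different from `i`, so the two flags share theirs.
        have hab : a = b := by
          have := h (facet a) (by simp; omega)
          simpa using this
        refine ⟨⟨fun hΦ => hne (liftFlag_inj.2 ⟨hΦ, hab⟩), fun x hx => ?_⟩, hab⟩
        by_cases hxt : x = t
        · subst hxt
          simp [Flag.greatest_mem ht]
        · have := h (proper x hxt) (by simpa using hx)
          simpa using this
      · rintro ⟨⟨hne, h⟩, hab⟩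
        obtain rfl : a = b := hab
        refine ⟨fun h' => hne (liftFlag_inj.1 h').1, fun F hF => ?_⟩
        cases F with
        | proper x hx => simpa using h x (by simpa using hF)
        | facet c => simp
        | top => simp

/-- Describing the fibre over `t` by rank shows that rank-preserving automorphisms respect it. -/
theorem collapse_eq_iff (K : Polytope n P) {t : P} (ht : ∀ x, x ≤ t) (q : DoubledFace t) :
    collapse q = t ↔ n ≤ K.doubledRank t q := by
  cases q with
  | proper x hx => simpa [hx] using K.rank_lt ht hx
  | facet b => simp
  | top => simp

/-- The induced map on `P` does not depend on the chosen lift: only the fibre over `t` has several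
points, and it is preserved. -/
theorem collapse_map_incl_collapse (K : Polytope n P) {t : P} (ht : ∀ x, x ≤ t)
    (δ : DoubledFace t ≃o DoubledFace t)
    (hδ : ∀ F, K.doubledRank t (δ F) = K.doubledRank t F) (b : Bool) (q : DoubledFace t) :
    collapse (δ (incl t b (collapse q))) = collapse (δ q) := by
  by_cases h : collapse q = t
  · rw [h, (K.collapse_eq_iff ht (δ q)).2 (by rwa [hδ, ← K.collapse_eq_iff ht]),
      K.collapse_eq_iff ht, hδ, incl_self, doubledRank_facet]
  · cases q with
    | proper x hx => rw [collapse_proper, incl_of_ne b hx]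
    | facet b => simp at h
    | top => simp at h

/-- The automorphism of a polytope induced by an automorphism of its trivial extension. -/
noncomputable def collapseIso (K : Polytope n P) {t : P} (ht : ∀ x, x ≤ t)
    (δ : DoubledFace t ≃o DoubledFace t)
    (hδ : ∀ F, K.doubledRank t (δ F) = K.doubledRank t F) : P ≃o P :=
  have hδ' : ∀ F, K.doubledRank t (δ.symm F) = K.doubledRank t F := fun F => by
    simpa using (hδ (δ.symm F)).symm
  have hm (ε : DoubledFace t ≃o DoubledFace t) :
      Monotone fun x => collapse (ε (incl t false x)) := fun x y h =>
    collapse_mono ht (ε.monotone ((incl_le_incl ht false).2 h))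
  Equiv.toOrderIso
    { toFun := fun x => collapse (δ (incl t false x))
      invFun := fun x => collapse (δ.symm (incl t false x))
      left_inv := fun x => by
        simp [K.collapse_map_incl_collapse ht δ.symm hδ']
      right_inv := fun x => by
        simp [K.collapse_map_incl_collapse ht δ hδ] }
    (hm δ) (hm δ.symm)

theorem collapseIso_apply (K : Polytope n P) {t : P} (ht : ∀ x, x ≤ t)
    (δ : DoubledFace t ≃o DoubledFace t)
    (hδ : ∀ F, K.doubledRank t (δ F) = K.doubledRank t F) (x : P) :
    K.collapseIso ht δ hδ x = collapse (δ (incl t false x)) := rfl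

theorem rank_collapseIso (K : Polytope n P) {t : P} (ht : ∀ x, x ≤ t)
    (δ : DoubledFace t ≃o DoubledFace t)
    (hδ : ∀ F, K.doubledRank t (δ F) = K.doubledRank t F) (x : P) :
    K.rank (K.collapseIso ht δ hδ x) = K.rank x := by
  rw [collapseIso_apply, ← K.doubledRank_incl ht false x, ← hδ]
  -- This excludes `top`, the only face whose rank `collapse` changes.
  have hle : K.doubledRank t (δ (incl t false x)) ≤ n := by
    rw [hδ, doubledRank_incl K ht]
    exact (K.rank_mem x).2
  cases h : δ (incl t false x) with
  | proper y hy => simp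
  | facet b => simp [K.rank_greatest ht]
  | top => simp [h] at hle

theorem _root_.Flag.map_eq_of_mapsTo {Q : Type u} [PartialOrder Q] (γ : Q ≃o Q) {Φ Ψ : Flag Q}
    (h : ∀ x ∈ Φ, γ x ∈ Ψ) : Flag.map γ Φ = Ψ := by
  refine Flag.eq_of_le fun y hy => ?_
  obtain ⟨x, hx, rfl⟩ : y ∈ γ '' (Φ : Set Q) := hy
  exact h x hx

theorem flagOrbitSetoid_double_iff (K : Polytope n P) {t : P} (ht : ∀ x, x ≤ t)
    (p q : Flag P × Bool) :
    (K.double ht).flagOrbitSetoid ((K.doubleFlagGraphIso ht).toEquiv p)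
      ((K.doubleFlagGraphIso ht).toEquiv q) ↔ K.flagOrbitSetoid p.1 q.1 := by
  obtain ⟨Φ, a⟩ := p
  obtain ⟨Ψ, b⟩ := q
  change (∃ δ : DoubledFace t ≃o DoubledFace t, (∀ F, K.doubledRank t (δ F) = K.doubledRank t F) ∧
    Flag.map δ (liftFlag ht Φ a) = liftFlag ht Ψ b) ↔
    ∃ γ : P ≃o P, (∀ F, K.rank (γ F) = K.rank F) ∧ Flag.map γ Φ = Ψ
  constructor
  · rintro ⟨δ, hδ, h⟩
    refine ⟨K.collapseIso ht δ hδ, K.rank_collapseIso ht δ hδ,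
      Flag.map_eq_of_mapsTo _ fun x hx => ?_⟩
    -- Switch from the lift through `false` to the one through `a`, which lies in the given flag
    -- even when `x = t`.
    rw [collapseIso_apply, show x = collapse (incl t a x) by simp,
      K.collapse_map_incl_collapse ht δ hδ]
    have hmem : δ (incl t a x) ∈ liftFlag ht Ψ b := by
      rw [← h, ← SetLike.mem_coe, Flag.coe_map]
      refine Set.mem_image_of_mem _ ?_
      by_cases hxt : x = t
      · simp [hxt]
      · simpa [incl_of_ne a hxt] using hx
    exact (mem_liftFlag.1 hmem).1
  · rintro ⟨γ, hγ, rfl⟩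
    have hγt : γ t = t := le_antisymm (ht _) (γ.symm_apply_le.1 (ht _))
    obtain ⟨σ, rfl⟩ := Bool.exists_equiv_apply_eq a b
    refine ⟨mapIso γ hγt σ, fun F => ?_, Flag.map_eq_of_mapsTo _ fun F hF => ?_⟩
    · cases F <;> simp [mapIso, mapFun, hγ]
    · cases F with
      | proper x hx =>
        have hx' : x ∈ Φ := by simpa using hF
        have : γ x ∈ Flag.map γ Φ := by
          rw [← SetLike.mem_coe, Flag.coe_map]
          exact Set.mem_image_of_mem _ hx'
        simpa [mapIso, mapFun] using this
      | facet c => simpa [mapIso, mapFun] using hF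
      | top => simp [mapIso, mapFun]

theorem nonempty_iso_symmetryTypeGraph_double (K : Polytope n P) {t : P} (ht : ∀ x, x ≤ t) :
    Nonempty ((K.double ht).symmetryTypeGraph.Iso K.symmetryTypeGraph.attachSemiEdges) :=
  LabelledGraph.nonempty_iso_quotient_attachSemiEdges _ _ _ _ (K.doubleFlagGraphIso ht)
    (K.flagOrbitSetoid_double_iff ht)

end Polytope

/-! ### Conclusion -/

theorem theoremt {n : ℕ} {V : Type u} (G : LabelledGraph n V) (hG : G.IsAllowable) :
    ((∃ (Ω : Type v) (M : LabelledGraph n Ω),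
        M.IsManiplex ∧ Nonempty (M.symmetryTypeGraph.Iso G)) →
      ∃ (Ω : Type v) (M : LabelledGraph (n + 1) Ω),
        M.IsManiplex ∧ Nonempty (M.symmetryTypeGraph.Iso G.attachSemiEdges)) ∧
    ((∃ (P : Type w) (_ : PartialOrder P) (K : Polytope n P),
        Nonempty (K.symmetryTypeGraph.Iso G)) →
      ∃ (Q : Type w) (_ : PartialOrder Q) (L : Polytope (n + 1) Q),
        Nonempty (L.symmetryTypeGraph.Iso G.attachSemiEdges)) := by
  constructor
  · rintro ⟨Ω, M, hM, ⟨f⟩⟩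
    obtain ⟨g⟩ := M.nonempty_iso_symmetryTypeGraph_double
    exact ⟨Ω × Bool, M.double, hM.double, ⟨g.trans f.attachSemiEdges⟩⟩
  · rintro ⟨P, _, K, ⟨f⟩⟩
    obtain ⟨t, ht, -⟩ := K.exists_greatest
    obtain ⟨g⟩ := K.nonempty_iso_symmetryTypeGraph_double ht
    exact ⟨DoubledFace t, inferInstance, K.double ht, ⟨g.trans f.attachSemiEdges⟩⟩
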